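/- Let $d,N\in\mathbb N\cup\{\infty\}$ and let $\mathbb F^d$ be the free monoid of words in $d$ letters. For a Hilbert space $\mathcal H$ let $H^2\otimes\mathcal H$ be the Hilbert space of power series $f=\sum_{\alpha\in\mathbb F^d}\hat f_\alpha z^\alpha$ in $d$ noncommuting variables with coefficients $\hat f_\alpha\in\mathcal H$ and $\sum_\alpha\|\hat f_\alpha\|^2<\infty$ (the full Fock space with coefficients in $\mathcal H$); put $H^2=H^2\otimes\mathbb C$. A left multiplier $F\in H^\infty\otimes\mathcal L(\mathcal H,\mathcal J)$ is a power series $F=\sum_\alpha F_\alpha z^\alpha$, $F_\alpha\in\mathcal L(\mathcal H,\mathcal J)$, such that left multiplication $h\mapsto Fh$, $(Fh)_\gamma=\sum_{\alpha\beta=\gamma}F_\alpha \hat h_\beta$, is a bounded operator $F(L):H^2\otimes\mathcal H\to H^2\otimes\mathcal J$. It is inner if $F(L)$ is an isometry. For $0<r\le 1$, $F(rL)$ denotes the left multiplication operator with coefficients $r^{|\alpha|}F_\alpha$. For $n\in\{1,2,\dots\}\cup\{\infty\}$ (with $\mathbb C^\infty:=\ell^2(\mathbb N)$) let $\mathbb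 B^d_n$ be the set of strict row contractions on $\mathbb C^n$, i.e. $Z=(Z_1,\dots,Z_d):\mathbb C^n\otimes\mathbb C^d\to\mathbb C^n$ with $\|Z\|<1$, and for $f\in H^2$ put $f(Z)=\sum_\alpha \hat f_\alpha Z^\alpha$. The left NC variety $\mathrm{Sing}(f)$ is the set of all pairs $(Z,y)$, with $Z\in\mathbb B^d_n$, $y\in\mathbb C^n$, $n\in\{1,2,\dots\}\cup\{\infty\}$, such that $y^*f(Z)=0$, and the singularity space of $f$ is $$\mathscr S(f)=\{h\in H^2 : y^*h(Z)=0 \text{ for all } (Z,y)\in \mathrm{Sing}(f)\}.$$ A scalar left multiplier $\Theta\in H^\infty$ is regarded as an element of $H^2$ through its power series. Let $\Theta\in H^\infty$ be NC inner, and let $B=(B_1,\dots,B_N)\in H^\infty\otimes\mathbb C^{1\times N}$ be an inner row left multiplier $B(L):H^2\otimes\mathbb C^N\to H^2$ with $$\mathrm{Ran}\,B(L)=\mathscr S(\Theta),$$ that is, $B$ is the Blaschke row-inner in the row-column factorization $\Theta=B\cdot S$ (with $S$ a column-inner of length $N$). Then for every $r\in(0,1]$ the operator $B(rL)$ is a well-defined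 bounded left multiplier $H^2\otimes\mathbb C^N\to H^2$, and it is injective. -/

import Mathlib

open scoped ENNReal

noncomputable section

namespace NCHardy

/-- The Hilbert space `H²(𝔹^d_ℕ) ⊗ E`, i.e. the full Fock space with coefficients in `E`: the
power series `f = ∑_α f_α z^α` in noncommuting variables with square-summable coefficients
`f_α ∈ E`.  The letters are indexed by `ι` (so `d` is the cardinality of `ι`), and words `α` in the
letters are lists; the empty word is `[]` and the product of words is concatenation. -/
abbrev H2 (ι E : Type*) [NormedAddCommGroup E] := lp (fun _ : List ι => E) 2

/-- `ℂ^N` with its Euclidean norm, for a finite or infinite index set `κ` of cardinality `N`. -/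
abbrev Euc (κ : Type*) := lp (fun _ : κ => ℂ) 2

/-- The Hilbert space `ℂ^n` of the `n`-th level, `n ∈ ℕ ∪ {∞}`; for `n = ⊤` it is `ℓ²(ℕ)`. -/
abbrev Level (n : ℕ∞) := Euc {k : ℕ // (k : ℕ∞) < n}

section Evaluation

variable {ι E : Type*} [NormedAddCommGroup E] [NormedSpace ℂ E]

open Classical in
/-- The component `Z_i` of a row operator `Z = (Z_i)_i`, viewed as a bounded linear map from the
Hilbert space direct sum of `d` copies of `E` to `E`. -/
def component (Z : lp (fun _ : ι => E) 2 →L[ℂ] E) (i : ι) : E →L[ℂ] E :=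
  Z ∘L lp.singleContinuousLinearMap ℂ (fun _ : ι => E) 2 i

/-- `Z^α = Z_{i_1} ⋯ Z_{i_n}` for the word `α = i_1 ⋯ i_n`. -/
def wordPow (Z : lp (fun _ : ι => E) 2 →L[ℂ] E) (α : List ι) : E →L[ℂ] E :=
  (α.map (component Z)).prod

/-- The value `f(Z) = ∑_α f_α Z^α` of `f ∈ H²` at a row operator `Z`, used for `‖Z‖ < 1` only.
The sum is then unconditionally convergent in operator norm. -/
def eval (f : H2 ι ℂ) (Z : lp (fun _ : ι => E) 2 →L[ℂ] E) : E →L[ℂ] E :=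
  ∑' α : List ι, f α • wordPow Z α

end Evaluation

/-- The level `n` part of the left NC variety of `f`: all `(Z, y)` with `Z` a strict row contraction
on `ℂ^n`, `y ∈ ℂ^n` and `y^* f(Z) ≡ 0`. -/
def Sing {ι : Type*} (f : H2 ι ℂ) (n : ℕ∞) :
    Set ((lp (fun _ : ι => Level n) 2 →L[ℂ] Level n) × Level n) :=
  {p | ‖p.1‖ < 1 ∧ ∀ x : Level n, inner ℂ p.2 (eval f p.1 x) = 0}

/-- The singularity space of `f`: all `h ∈ H²` with `y^* h(Z) ≡ 0` for every `(Z, y)` in the left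
NC variety of `f`, at all levels `n ∈ ℕ ∪ {∞}`. -/
def singularitySpace {ι : Type*} (f : H2 ι ℂ) : Set (H2 ι ℂ) :=
  {h | ∀ n : ℕ∞, 1 ≤ n → ∀ p ∈ Sing f n, ∀ x : Level n, inner ℂ p.2 (eval h p.1 x) = 0}

/-- An element `F` of `H^∞(𝔹^d_ℕ) ⊗ L(E, J)`: a power series `F = ∑_α F_α z^α` with coefficients in
`L(E, J)`, such that left multiplication by it is a bounded operator `F(L)` from `H² ⊗ E` to
`H² ⊗ J`.  The coefficient of `F h` at `γ` is `∑_{αβ = γ} F_α h_β`; the factorizations `γ = αβ`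
correspond to the lengths `k = 0, …, |γ|` of `α`. -/
structure LeftMultiplier (ι E J : Type*) [NormedAddCommGroup E] [NormedSpace ℂ E]
    [NormedAddCommGroup J] [NormedSpace ℂ J] where
  /-- the power series coefficients `F_α` -/
  coeff : List ι → E →L[ℂ] J
  /-- the multiplication operator `F(L)` -/
  op : H2 ι E →L[ℂ] H2 ι J
  op_apply : ∀ (h : H2 ι E) (γ : List ι),
    op h γ = ∑ k ∈ Finset.range (γ.length + 1), coeff (γ.take k) (h (γ.drop k))

namespace LeftMultiplier

variable {ι E J : Type*} [NormedAddCommGroup E] [NormedSpace ℂ E]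
  [NormedAddCommGroup J] [NormedSpace ℂ J]

/-- `F` is inner if `F(L)` is an isometry. -/
def IsInner (F : LeftMultiplier ι E J) : Prop := Isometry F.op

/-- `G(L) = F(rL)`, i.e. `G_α = r^{|α|} F_α` for every word `α`. -/
def IsDilation (r : ℝ) (F G : LeftMultiplier ι E J) : Prop :=
  ∀ α : List ι, G.coeff α = ((r : ℂ) ^ α.length) • F.coeff α

open Classical in
/-- The element `F = F(L) 1` of `H²` given by a scalar left multiplier (the inclusion
`H^∞ ⊆ H²`, which keeps the power series). -/
def toH2 (F : LeftMultiplier ι ℂ ℂ) : H2 ι ℂ := F.op (lp.single 2 [] 1)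

end LeftMultiplier

/-- `B` is a Blaschke row-inner factor of the scalar NC inner `Θ`: a row `B = (B_k)_{k ∈ κ}` of left
multipliers that is inner, with `Ran B(L)` equal to the singularity space of `Θ`. -/
structure IsBlaschkeRowFactor {ι κ : Type*} (Θ : LeftMultiplier ι ℂ ℂ)
    (B : LeftMultiplier ι (Euc κ) ℂ) : Prop where
  inner : B.IsInner
  range_eq : Set.range B.op = singularitySpace Θ.toH2

end NCHardy

end

/-!
The point is that a row inner `B` whose range is the singularity space of some `f ≠ 0` has at most
one entry (`subsingleton_of_range_eq_singularitySpace`). Given this, `B(rL)` is a scalar left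
multiplier: for `r < 1` it is bounded because it is the value of a scalar power series at the
strict row contraction `rL` (`exists_isDilation`), and it is injective because the free monoid ring
has no zero divisors (`LeftMultiplier.injective_op`). For `r = 1` it is the isometry `B(L)`.

Write `f_r` for the power series with coefficients `r^{|α|} f_α`. Let `M_r` be the closed
right-shift invariant subspace generated by `f_r`, that is, the closure of the range of `f(rL)`.

* For `r < 1`, evaluation at the points `(rL, y)` with `y ⟂ M_r` shows that `b_r ∈ M_r` for every
  `b` in the singularity space of `f` (`dilate_mem_cyclic`).
* A cyclic invariant subspace is generated by an inner `v_r ∈ M_r`: the shifts `v_r z^β` are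
  orthonormal, and every `g ∈ M_r` is a Cauchy product `g = v_r c` with `‖c‖ = ‖g‖`
  (`exists_inner_generator`).
* Let `r → 1` along an ultrafilter. The `v_r` have a coefficientwise limit `V`, which again lies in
  the singularity space of `f`: if `y^* f(Z) = 0`, then `y^* v_r(Z / r) = 0` as soon as `‖Z‖ < r`
  (`mem_singularitySpace_of_tendsto`). Hence `V = B G` for some `G ∈ H² ⊗ ℂ^N`.
* For a constant `e ∈ ℂ^N` and `b = B e`, the factorizations `b_r = v_r c_r` pass to the limit and
  give `B e = V w = B (G w)`. Since `B` is injective, `e = G w`, and comparing the constant terms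
  gives `e = w_∅ G_∅`. So `G_∅` spans `ℂ^N`, and `N ≤ 1`.
-/

noncomputable section

namespace NCHardy

/-! ### Square-summable families -/

section SquareSummable

variable {A C E : Type*} [NormedAddCommGroup E]

lemma memℓp_two_iff {f : A → E} : Memℓp f 2 ↔ Summable fun a => ‖f a‖ ^ 2 := by
  rw [memℓp_gen_iff (by simp)]
  simp

lemma summable_norm_sq (h : lp (fun _ : A => E) 2) : Summable fun a => ‖h a‖ ^ 2 :=
  memℓp_two_iff.1 (lp.memℓp h)

lemma norm_sq_eq_tsum (h : lp (fun _ : A => E) 2) : ‖h‖ ^ 2 = ∑' a, ‖h a‖ ^ 2 := by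
  have := lp.norm_rpow_eq_tsum (p := 2) (by simp) h
  simpa using this

lemma sum_norm_sq_le (h : lp (fun _ : A => E) 2) (s : Finset A) :
    ∑ a ∈ s, ‖h a‖ ^ 2 ≤ ‖h‖ ^ 2 := by
  rw [norm_sq_eq_tsum]
  exact (summable_norm_sq h).sum_le_tsum _ fun _ _ => by positivity

/-- A family whose finite sums are dominated, in the square of the norm, by the finite sums of a
summable family is summable. -/
lemma summable_of_norm_sum_sq_le [CompleteSpace E] {f : A → E} {u : A → ℝ} (hu : Summable u)
    {K : ℝ} (h : ∀ s : Finset A, ‖∑ a ∈ s, f a‖ ^ 2 ≤ K * ∑ a ∈ s, u a) : Summable f := by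
  rw [summable_iff_vanishing_norm]
  intro ε hε
  obtain ⟨s, hs⟩ := summable_iff_vanishing_norm.1 (hu.mul_left K) (ε ^ 2) (by positivity)
  refine ⟨s, fun t ht => ?_⟩
  have h1 := hs t ht
  rw [← Finset.mul_sum] at h1
  exact lt_of_pow_lt_pow_left₀ 2 hε.le (((h t).trans (le_abs_self _)).trans_lt h1)

variable [NormedSpace ℂ E]

/-- Transport of square-summable families along an injective map of index sets, extending them by
zero outside its range. -/
def extendIsometry (e : A → C) (he : Function.Injective e) :
    lp (fun _ : A => E) 2 →ₗᵢ[ℂ] lp (fun _ : C => E) 2 where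
  toFun h := ⟨Function.extend e h 0, memℓp_two_iff.2 <| by
    have := (Function.Injective.summable_iff (f := fun c => ‖Function.extend e h 0 c‖ ^ 2) he
      (fun c hc => by simp [Function.extend_apply' _ _ _ hc])).1
    refine this ?_
    simpa [Function.comp_def, he.extend_apply] using summable_norm_sq h⟩
  map_add' g h := by
    ext c
    by_cases hc : ∃ a, e a = c
    · obtain ⟨a, rfl⟩ := hc
      change Function.extend e (⇑g + ⇑h) 0 (e a) =
        Function.extend e g 0 (e a) + Function.extend e h 0 (e a)
      simp [he.extend_apply]
    · change Function.extend e (⇑g + ⇑h) 0 c =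
        Function.extend e g 0 c + Function.extend e h 0 c
      simp [Function.extend_apply' _ _ _ hc]
  map_smul' z h := by
    ext c
    by_cases hc : ∃ a, e a = c
    · obtain ⟨a, rfl⟩ := hc
      simp [he.extend_apply]
    · simp [Function.extend_apply' _ _ _ hc]
  norm_map' h := by
    rw [← sq_eq_sq₀ (norm_nonneg _) (norm_nonneg _), norm_sq_eq_tsum, norm_sq_eq_tsum]
    refine (Function.Injective.tsum_eq he fun c hc => ?_).symm.trans ?_
    · by_contra hc'
      exact hc (by simp [Function.extend_apply' _ _ _ hc'])
    · simp [he.extend_apply]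

@[simp]
lemma extendIsometry_apply (e : A → C) (he : Function.Injective e) (h : lp (fun _ : A => E) 2)
    (a : A) : extendIsometry e he h (e a) = h a :=
  he.extend_apply _ _ _

lemma extendIsometry_apply_of_notMem (e : A → C) (he : Function.Injective e)
    (h : lp (fun _ : A => E) 2) {c : C} (hc : ∀ a, e a ≠ c) : extendIsometry e he h c = 0 :=
  Function.extend_apply' _ _ _ (by simpa using hc)

lemma extendIsometry_single [DecidableEq A] [DecidableEq C] (e : A → C)
    (he : Function.Injective e) (a : A) (x : E) :
    extendIsometry e he (lp.single 2 a x) = lp.single 2 (e a) x := by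
  ext c
  by_cases hc : ∃ a, e a = c
  · obtain ⟨b, rfl⟩ := hc
    rw [extendIsometry_apply]
    by_cases h : b = a
    · subst h; simp
    · rw [lp.single_apply_ne _ _ _ h, lp.single_apply_ne _ _ _ (he.ne h)]
  · rw [extendIsometry_apply_of_notMem _ _ _ (by simpa using hc),
      lp.single_apply_ne _ _ _ (fun h => hc ⟨a, h.symm⟩)]

end SquareSummable

section Inner

variable {A C : Type*}

lemma hasSum_inner_extendIsometry {E : Type*} [NormedAddCommGroup E] [InnerProductSpace ℂ E]
    (e : A → C) (he : Function.Injective e)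
    (g : lp (fun _ : C => E) 2) (h : lp (fun _ : A => E) 2) :
    HasSum (fun a => inner ℂ (g (e a)) (h a)) (inner ℂ g (extendIsometry e he h)) := by
  have := lp.hasSum_inner (𝕜 := ℂ) g (extendIsometry e he h)
  rw [← he.hasSum_iff] at this
  · simpa [Function.comp_def] using this
  · intro c hc
    rw [extendIsometry_apply_of_notMem e he h (by simpa using hc), inner_zero_right]

/-- A bounded family of square-summable functions that converges pointwise converges weakly. -/
lemma tendsto_inner_of_tendsto_apply {X : Type*} {l : Filter X} {W : X → lp (fun _ : A => ℂ) 2}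
    {w : lp (fun _ : A => ℂ) 2} {M : ℝ} (hM : ∀ x, ‖W x‖ ≤ M)
    (hW : ∀ a, Filter.Tendsto (fun x => W x a) l (nhds (w a))) (k : lp (fun _ : A => ℂ) 2) :
    Filter.Tendsto (fun x => inner ℂ k (W x)) l (nhds (inner ℂ k w)) := by
  classical
  -- It suffices to treat finitely supported `k`, which are dense.
  have hM' : ∀ x, ‖W x - w‖ ≤ |M| + ‖w‖ := fun x =>
    (norm_sub_le _ _).trans (by gcongr; exact (hM x).trans (le_abs_self _))
  set D := |M| + ‖w‖ + 1 with hD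
  have hDpos : 0 < D := by positivity
  have hfin : ∀ s : Finset A, Filter.Tendsto
      (fun x => inner ℂ (∑ a ∈ s, lp.single 2 a (k a)) (W x - w)) l (nhds 0) := by
    intro s
    have : Filter.Tendsto (fun x => ∑ a ∈ s, inner ℂ (k a) (W x a - w a)) l
        (nhds (∑ a ∈ s, inner ℂ (k a) (w a - w a))) :=
      tendsto_finsetSum _ fun a _ => tendsto_const_nhds.inner ((hW a).sub_const _)
    simpa only [sum_inner, lp.inner_single_left, lp.coeFn_sub, Pi.sub_apply, sub_self,
      inner_zero_right, Finset.sum_const_zero] using this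
  rw [← tendsto_sub_nhds_zero_iff]
  simp_rw [← inner_sub_right]
  rw [Metric.tendsto_nhds]
  intro ε hε
  obtain ⟨s, hs⟩ := ((Metric.tendsto_nhds.1
    (lp.hasSum_single (by simp : (2 : ℝ≥0∞) ≠ ⊤) k)) (ε / 2 / D) (by positivity)).exists
  filter_upwards [Metric.tendsto_nhds.1 (hfin s) (ε / 2) (by positivity)] with x hx
  rw [dist_zero_right] at hx ⊢
  rw [dist_comm, dist_eq_norm] at hs
  have h1 : inner ℂ k (W x - w) = inner ℂ (k - ∑ a ∈ s, lp.single 2 a (k a)) (W x - w)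
      + inner ℂ (∑ a ∈ s, lp.single 2 a (k a)) (W x - w) := by
    rw [← inner_add_left, sub_add_cancel]
  rw [h1]
  refine (norm_add_le _ _).trans_lt ?_
  have h2 : ‖inner ℂ (k - ∑ a ∈ s, lp.single 2 a (k a)) (W x - w)‖ ≤ ε / 2 := by
    refine (norm_inner_le_norm _ _).trans ?_
    calc _ ≤ (ε / 2 / D) * D := by
          gcongr
          exact (hM' x).trans (by rw [hD]; linarith)
      _ = ε / 2 := by field_simp
  linarith

end Inner

/-! ### Right shifts and dilations of power series -/

section Shift

variable {ι E : Type*} [NormedAddCommGroup E] [NormedSpace ℂ E]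

lemma exists_forall_length_lt_not {P : List ι → Prop} (h : ∃ α, P α) :
    ∃ α, P α ∧ ∀ β : List ι, β.length < α.length → ¬ P β := by
  obtain ⟨α, hα, hmin⟩ := (measure (List.length (α := ι))).wf.has_min {α | P α} h
  exact ⟨α, hα, fun β hβ hP => hmin β hP hβ⟩

/-- Right multiplication `h ↦ h z^β` by a monomial. -/
def rightShift (β : List ι) : H2 ι E →ₗᵢ[ℂ] H2 ι E :=
  extendIsometry (fun α => α ++ β) (List.append_left_injective β)

@[simp]
lemma rightShift_append (β : List ι) (h : H2 ι E) (α : List ι) :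
    rightShift β h (α ++ β) = h α :=
  extendIsometry_apply (fun α => α ++ β) _ h α

lemma rightShift_of_not_suffix {β γ : List ι} (h : H2 ι E) (hγ : ¬ β <:+ γ) :
    rightShift β h γ = 0 :=
  extendIsometry_apply_of_notMem _ _ h fun α hα => hγ ⟨α, hα⟩

lemma rightShift_single [DecidableEq ι] (α β : List ι) (x : E) :
    rightShift β (lp.single 2 α x) = (lp.single 2 (α ++ β) x : H2 ι E) :=
  extendIsometry_single _ _ _ _

@[simp]
lemma rightShift_nil (h : H2 ι E) : rightShift [] h = h := by
  ext γ
  have := rightShift_append [] h γ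
  rwa [List.append_nil] at this

lemma rightShift_rightShift (α β : List ι) (h : H2 ι E) :
    rightShift β (rightShift α h) = rightShift (α ++ β) h := by
  ext γ
  by_cases hγ : β <:+ γ
  · obtain ⟨δ, rfl⟩ := hγ
    rw [rightShift_append]
    by_cases hδ : α <:+ δ
    · obtain ⟨η, rfl⟩ := hδ
      rw [rightShift_append, List.append_assoc, rightShift_append]
    · rw [rightShift_of_not_suffix _ hδ, rightShift_of_not_suffix]
      rintro ⟨η, hη⟩
      rw [← List.append_assoc] at hη
      exact hδ ⟨η, List.append_cancel_right hη⟩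
  · rw [rightShift_of_not_suffix _ hγ, rightShift_of_not_suffix]
    exact fun h => hγ ((List.suffix_append α β).trans h)

/-- The coefficients of `z^β` times a scalar power series, summed against scalars `c_β`, are those
of the Cauchy product. -/
lemma hasSum_smul_rightShift_apply (v : H2 ι E) (c : List ι → ℂ) (γ : List ι) :
    HasSum (fun β => c β • rightShift β v γ)
      (∑ k ∈ Finset.range (γ.length + 1), c (γ.drop k) • v (γ.take k)) := by
  classical
  have hinj : Set.InjOn (fun k => γ.drop k) (Finset.range (γ.length + 1)) := by
    intro j hj k hk hjk
    have := congrArg List.length hjk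
    simp at this hj hk
    omega
  have h := hasSum_sum_of_ne_finset_zero (f := fun β => c β • rightShift β v γ)
    (L := SummationFilter.unconditional _)
    (s := (Finset.range (γ.length + 1)).image fun k => γ.drop k) (fun β hβ => by
      rw [rightShift_of_not_suffix, smul_zero]
      rintro ⟨α, rfl⟩
      exact hβ (Finset.mem_image.2 ⟨α.length, by simp, by simp⟩))
  rw [Finset.sum_image hinj] at h
  convert h using 1
  refine Finset.sum_congr rfl fun k _ => ?_
  have := rightShift_append (γ.drop k) v (γ.take k)
  rw [List.take_append_drop] at this
  rw [this]

/-- The dilation `f ↦ f_r`, `(f_r)_α = r^{|α|} f_α`. -/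
def dilate (r : unitInterval) : H2 ι ℂ →L[ℂ] H2 ι ℂ :=
  LinearMap.mkContinuous
    { toFun := fun f => ⟨fun α => ((r : ℝ) : ℂ) ^ α.length * f α, memℓp_two_iff.2 <|
        Summable.of_nonneg_of_le (fun _ => by positivity) (fun α => by
          rw [norm_mul, mul_pow]
          refine mul_le_of_le_one_left (by positivity) (pow_le_one₀ (by positivity) ?_)
          simpa [abs_of_nonneg r.2.1] using pow_le_one₀ r.2.1 r.2.2) (summable_norm_sq f)⟩
      map_add' := fun f g => by ext α; exact mul_add _ _ _
      map_smul' := fun c f => by ext α; simp; ring } 1 fun f => by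
    rw [one_mul, ← sq_le_sq₀ (norm_nonneg _) (norm_nonneg _), norm_sq_eq_tsum, norm_sq_eq_tsum]
    refine Summable.tsum_le_tsum (fun α => ?_) (summable_norm_sq _) (summable_norm_sq _)
    simp only [LinearMap.coe_mk, AddHom.coe_mk, norm_mul, mul_pow]
    refine mul_le_of_le_one_left (by positivity) (pow_le_one₀ (by positivity) ?_)
    simpa [abs_of_nonneg r.2.1] using pow_le_one₀ r.2.1 r.2.2

@[simp]
lemma dilate_apply (r : unitInterval) (f : H2 ι ℂ) (α : List ι) :
    dilate r f α = ((r : ℝ) : ℂ) ^ α.length * f α := rfl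

lemma norm_dilate_le (r : unitInterval) (f : H2 ι ℂ) : ‖dilate r f‖ ≤ ‖f‖ := by
  simpa using (dilate r).le_of_opNorm_le (LinearMap.mkContinuous_norm_le _ zero_le_one _) f

end Shift

/-! ### Evaluation at strict row contractions -/

section Evaluation

variable {ι E : Type*} [NormedAddCommGroup E] [InnerProductSpace ℂ E]

open ContinuousLinearMap (adjoint)

@[simp]
lemma wordPow_nil (Z : lp (fun _ : ι => E) 2 →L[ℂ] E) : wordPow Z [] = 1 := rfl

lemma wordPow_cons (Z : lp (fun _ : ι => E) 2 →L[ℂ] E) (i : ι) (α : List ι) :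
    wordPow Z (i :: α) = component Z i * wordPow Z α := by
  simp [wordPow]

lemma wordPow_append (Z : lp (fun _ : ι => E) 2 →L[ℂ] E) (α β : List ι) :
    wordPow Z (α ++ β) = wordPow Z α * wordPow Z β := by
  simp [wordPow]

lemma wordPow_smul (c : ℂ) (Z : lp (fun _ : ι => E) 2 →L[ℂ] E) (α : List ι) :
    wordPow (c • Z) α = c ^ α.length • wordPow Z α := by
  induction α with
  | nil => simp
  | cons i α ih =>
    have : component (c • Z) i = c • component Z i := by
      simp [component, ContinuousLinearMap.smul_comp]
    rw [wordPow_cons, wordPow_cons, ih, this, List.length_cons, pow_succ', smul_mul_smul_comm]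

variable [CompleteSpace E]

lemma adjoint_apply_eq_adjoint_component (Z : lp (fun _ : ι => E) 2 →L[ℂ] E) (y : E) (i : ι) :
    adjoint Z y i = adjoint (component Z i) y := by
  classical
  refine ext_inner_left ℂ fun x => ?_
  rw [ContinuousLinearMap.adjoint_inner_right, component, ContinuousLinearMap.comp_apply,
    ← ContinuousLinearMap.adjoint_inner_right Z, lp.singleContinuousLinearMap_apply,
    lp.inner_single_left]

lemma sum_norm_adjoint_component_sq_le (Z : lp (fun _ : ι => E) 2 →L[ℂ] E) (y : E)
    (s : Finset ι) :
    ∑ i ∈ s, ‖adjoint (component Z i) y‖ ^ 2 ≤ ‖Z‖ ^ 2 * ‖y‖ ^ 2 := by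
  simp_rw [← adjoint_apply_eq_adjoint_component]
  refine (sum_norm_sq_le _ s).trans ?_
  rw [← mul_pow]
  gcongr
  simpa using (adjoint Z).le_opNorm y

/-- The square of the norm of the column `(Z^α)^*`, over all words `α`, is at most the geometric
sum `∑ ‖Z‖^{2n}`. -/
lemma sum_norm_adjoint_wordPow_sq_le {Z : lp (fun _ : ι => E) 2 →L[ℂ] E} (hZ : ‖Z‖ < 1)
    (s : Finset (List ι)) (y : E) :
    ∑ α ∈ s, ‖adjoint (wordPow Z α) y‖ ^ 2 ≤ (1 - ‖Z‖ ^ 2)⁻¹ * ‖y‖ ^ 2 := by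
  classical
  set K := (1 - ‖Z‖ ^ 2)⁻¹ with hK
  have hpos : 0 < 1 - ‖Z‖ ^ 2 := by nlinarith [norm_nonneg Z]
  have hKpos : 0 < K := inv_pos.2 hpos
  have hK1 : 1 + K * ‖Z‖ ^ 2 = K := by
    rw [hK]; field_simp; ring
  suffices H : ∀ n : ℕ, ∀ s : Finset (List ι), (∀ α ∈ s, α.length < n) → ∀ y : E,
      ∑ α ∈ s, ‖adjoint (wordPow Z α) y‖ ^ 2 ≤ K * ‖y‖ ^ 2 from
    H (s.sup List.length + 1) s (fun α hα => Nat.lt_succ_of_le (Finset.le_sup hα)) y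
  intro n
  induction n with
  | zero =>
    intro s hs y
    have : s = ∅ := Finset.eq_empty_of_forall_notMem fun α hα => Nat.not_lt_zero _ (hs α hα)
    subst this
    simpa using by positivity
  | succ n ih =>
    intro s hs y
    -- Enlarge `s` to the set of `[]` and all `i :: β` with `i ∈ I`, `β ∈ T`.
    set I := s.biUnion List.toFinset
    set T := (s.image List.tail).filter fun β => β.length < n
    have hsub : s ⊆ insert [] ((I ×ˢ T).image fun p => p.1 :: p.2) := by
      intro α hα
      rcases α with _ | ⟨i, β⟩
      · simp
      · refine Finset.mem_insert_of_mem (Finset.mem_image.2 ⟨(i, β), ?_, rfl⟩)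
        refine Finset.mem_product.2 ⟨Finset.mem_biUnion.2 ⟨_, hα, by simp⟩,
          Finset.mem_filter.2 ⟨Finset.mem_image.2 ⟨_, hα, rfl⟩, ?_⟩⟩
        simpa using hs _ hα
    refine (Finset.sum_le_sum_of_subset_of_nonneg hsub fun _ _ _ => by positivity).trans ?_
    rw [Finset.sum_insert (by simp), Finset.sum_image (by
      rintro ⟨i, β⟩ - ⟨j, γ⟩ - h
      simpa using h), Finset.sum_product]
    have h1 : ∀ i ∈ I, ∑ β ∈ T, ‖adjoint (wordPow Z (i :: β)) y‖ ^ 2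
        ≤ K * ‖adjoint (component Z i) y‖ ^ 2 := fun i _ => by
      refine le_trans (le_of_eq ?_) (ih T (fun β hβ => (Finset.mem_filter.1 hβ).2)
        (adjoint (component Z i) y))
      refine Finset.sum_congr rfl fun β _ => ?_
      rw [wordPow_cons, ContinuousLinearMap.mul_def, ContinuousLinearMap.adjoint_comp,
        ContinuousLinearMap.comp_apply]
    calc _ ≤ ‖y‖ ^ 2 + ∑ i ∈ I, K * ‖adjoint (component Z i) y‖ ^ 2 := by
          refine add_le_add (le_of_eq ?_) (Finset.sum_le_sum h1)
          rw [wordPow_nil, ← ContinuousLinearMap.star_eq_adjoint, star_one,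
            one_apply_eq_self]
      _ ≤ ‖y‖ ^ 2 + K * (‖Z‖ ^ 2 * ‖y‖ ^ 2) := by
          rw [← Finset.mul_sum]
          gcongr
          exact sum_norm_adjoint_component_sq_le Z y I
      _ = K * ‖y‖ ^ 2 := by
          rw [← mul_assoc, ← one_add_mul, hK1]

/-- The power series of `f ∈ H²` converges in operator norm at a strict row contraction. -/
lemma summable_eval {Z : lp (fun _ : ι => E) 2 →L[ℂ] E} (hZ : ‖Z‖ < 1) (f : H2 ι ℂ) :
    Summable fun α => f α • wordPow Z α := by
  have hpos : 0 < 1 - ‖Z‖ ^ 2 := by nlinarith [norm_nonneg Z]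
  refine summable_of_norm_sum_sq_le (summable_norm_sq f) (K := (1 - ‖Z‖ ^ 2)⁻¹) fun s => ?_
  set T := ∑ α ∈ s, f α • wordPow Z α with hT
  set q := ∑ α ∈ s, ‖f α‖ ^ 2 with hq
  have hqnn : 0 ≤ q := Finset.sum_nonneg fun _ _ => by positivity
  have h1 : ‖T‖ ≤ √((1 - ‖Z‖ ^ 2)⁻¹ * q) := by
    rw [← LinearIsometryEquiv.norm_map adjoint T]
    refine ContinuousLinearMap.opNorm_le_bound _ (Real.sqrt_nonneg _) fun y => ?_
    have h2 : adjoint T y = ∑ α ∈ s, (starRingEnd ℂ) (f α) • adjoint (wordPow Z α) y := by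
      simp [hT, map_sum, map_smulₛₗ]
    rw [h2]
    refine (norm_sum_le _ _).trans ?_
    simp_rw [norm_smul, RCLike.norm_conj]
    refine (Real.sum_mul_le_sqrt_mul_sqrt _ _ _).trans ?_
    rw [← hq, Real.sqrt_mul (by positivity), mul_comm, mul_right_comm]
    gcongr
    rw [Real.sqrt_le_left (by positivity), mul_pow, Real.sq_sqrt (by positivity)]
    exact sum_norm_adjoint_wordPow_sq_le hZ s y
  calc ‖T‖ ^ 2 ≤ √((1 - ‖Z‖ ^ 2)⁻¹ * q) ^ 2 := by gcongr
    _ = _ := Real.sq_sqrt (by positivity)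

lemma hasSum_eval_apply {Z : lp (fun _ : ι => E) 2 →L[ℂ] E} (hZ : ‖Z‖ < 1) (f : H2 ι ℂ) (x : E) :
    HasSum (fun α => f α • wordPow Z α x) (eval f Z x) := by
  have h : HasSum (fun α => f α • wordPow Z α) (eval f Z) := (summable_eval hZ f).hasSum
  have h' := (ContinuousLinearMap.apply ℂ E x).hasSum h
  simpa only [ContinuousLinearMap.apply_apply, smul_apply] using h'

/-- The reproducing kernel `(⟨Z^α x, y⟩)_α` at a strict row contraction `Z`: the functional
`f ↦ y^* f(Z) x` is bounded on `H²`. -/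
lemma exists_kernel {Z : lp (fun _ : ι => E) 2 →L[ℂ] E} (hZ : ‖Z‖ < 1) (x y : E) :
    ∃ k : H2 ι ℂ, (∀ α, k α = inner ℂ (wordPow Z α x) y) ∧
      ∀ f : H2 ι ℂ, inner ℂ k f = inner ℂ y (eval f Z x) := by
  have hmem : Memℓp (fun α => inner ℂ (wordPow Z α x) y) 2 := by
    rw [memℓp_two_iff]
    refine summable_of_sum_le (c := (1 - ‖Z‖ ^ 2)⁻¹ * ‖y‖ ^ 2 * ‖x‖ ^ 2)
      (fun _ => by positivity) fun s => ?_
    refine le_trans ?_ (mul_le_mul_of_nonneg_right (sum_norm_adjoint_wordPow_sq_le hZ s y)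
      (by positivity))
    rw [Finset.sum_mul]
    refine Finset.sum_le_sum fun α _ => ?_
    rw [← ContinuousLinearMap.adjoint_inner_right, mul_comm, ← mul_pow]
    gcongr
    exact norm_inner_le_norm _ _
  refine ⟨⟨_, hmem⟩, fun α => rfl, fun f => ?_⟩
  refine (lp.hasSum_inner (𝕜 := ℂ) (⟨_, hmem⟩ : H2 ι ℂ) f).unique ?_
  have := (innerSL ℂ y).hasSum (hasSum_eval_apply hZ f x)
  simpa [Function.comp_def, inner_smul_right] using this

end Evaluation

/-! ### The scaled left shift -/

section LeftShift

variable {ι E : Type*} [NormedAddCommGroup E] [InnerProductSpace ℂ E]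

lemma orthogonalFamily_leftShift (e : HilbertBasis (List ι) ℂ E) :
    OrthogonalFamily ℂ (fun _ : ι => E) fun i =>
      (e.repr.symm.toLinearIsometry.comp
        (extendIsometry (fun α : List ι => i :: α) List.cons_injective)).comp
          e.repr.toLinearIsometry := by
  intro i j hij x y
  simp only [LinearIsometry.coe_comp, LinearIsometryEquiv.coe_toLinearIsometry,
    Function.comp_apply, LinearIsometryEquiv.inner_map_map]
  refine (hasSum_inner_extendIsometry _ _ _ _).unique ?_
  convert hasSum_zero with α
  rw [extendIsometry_apply_of_notMem, inner_zero_left]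
  simp [hij]

variable [CompleteSpace E]

/-- The row `r L = (r L_i)_i` of scaled left shifts `L_i e_α = e_{iα}`, on a Hilbert space with an
orthonormal basis `e` indexed by the words. -/
def scaledLeftShift (e : HilbertBasis (List ι) ℂ E) (r : unitInterval) :
    lp (fun _ : ι => E) 2 →L[ℂ] E :=
  ((r : ℝ) : ℂ) • (orthogonalFamily_leftShift e).linearIsometry.toContinuousLinearMap

lemma norm_scaledLeftShift_le (e : HilbertBasis (List ι) ℂ E) (r : unitInterval) :
    ‖scaledLeftShift e r‖ ≤ r := by
  refine ContinuousLinearMap.opNorm_le_bound _ r.2.1 fun x => le_of_eq ?_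
  rw [scaledLeftShift, smul_apply, norm_smul,
    LinearIsometry.coe_toContinuousLinearMap, LinearIsometry.norm_map]
  simp [abs_of_nonneg r.2.1]

lemma wordPow_scaledLeftShift (e : HilbertBasis (List ι) ℂ E) (r : unitInterval)
    (α β : List ι) :
    wordPow (scaledLeftShift e r) α (e β) = ((r : ℝ) : ℂ) ^ α.length • e (α ++ β) := by
  classical
  rw [scaledLeftShift, wordPow_smul, smul_apply]
  congr 1
  induction α with
  | nil => simp
  | cons i α ih =>
    rw [wordPow_cons, mul_apply_eq_comp, ih]
    simp only [component, ContinuousLinearMap.comp_apply, lp.singleContinuousLinearMap_apply,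
      LinearIsometry.coe_toContinuousLinearMap]
    have h := (orthogonalFamily_leftShift e).linearIsometry_apply_single (i := i) (e (α ++ β))
    refine Eq.trans ?_ (h.trans ?_)
    · congr! 
    · simp [HilbertBasis.repr_self, extendIsometry_single]

end LeftShift

/-! ### Cyclic invariant subspaces of the right shifts -/

section Cyclic

variable {ι : Type*}

open ContinuousLinearMap (adjoint)
open scoped InnerProductSpace

/-- The closed subspace of `H²` spanned by `f z^β` with `β` in a set `S` of words. -/
def shiftSpan (f : H2 ι ℂ) (S : Set (List ι)) : Submodule ℂ (H2 ι ℂ) :=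
  (Submodule.span ℂ ((fun β => rightShift β f) '' S)).topologicalClosure

/-- The closed right-shift invariant subspace of `H²` generated by `f`. -/
abbrev cyclic (f : H2 ι ℂ) : Submodule ℂ (H2 ι ℂ) := shiftSpan f Set.univ

lemma isClosed_shiftSpan (f : H2 ι ℂ) (S : Set (List ι)) :
    IsClosed (shiftSpan f S : Set (H2 ι ℂ)) :=
  Submodule.isClosed_topologicalClosure _

instance (f : H2 ι ℂ) (S : Set (List ι)) : CompleteSpace (shiftSpan f S) :=
  (isClosed_shiftSpan f S).completeSpace_coe

lemma rightShift_mem_shiftSpan (f : H2 ι ℂ) {S : Set (List ι)} {β : List ι} (hβ : β ∈ S) :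
    rightShift β f ∈ shiftSpan f S :=
  Submodule.le_topologicalClosure _ (Submodule.subset_span ⟨β, hβ, rfl⟩)

lemma self_mem_cyclic (f : H2 ι ℂ) : f ∈ cyclic f := by
  simpa using rightShift_mem_shiftSpan f (Set.mem_univ [])

lemma shiftSpan_le {f : H2 ι ℂ} {S : Set (List ι)} {K : Submodule ℂ (H2 ι ℂ)}
    (hK : IsClosed (K : Set (H2 ι ℂ))) (h : ∀ β ∈ S, rightShift β f ∈ K) : shiftSpan f S ≤ K :=
  Submodule.topologicalClosure_minimal _
    (Submodule.span_le.2 (by rintro _ ⟨β, hβ, rfl⟩; exact h β hβ)) hK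

lemma map_mem_of_mem_shiftSpan {F : Type*} [NormedAddCommGroup F] [NormedSpace ℂ F]
    (T : H2 ι ℂ →L[ℂ] F) {f : H2 ι ℂ} {S : Set (List ι)} {K : Submodule ℂ F}
    (hK : IsClosed (K : Set F)) (h : ∀ β ∈ S, T (rightShift β f) ∈ K) {g : H2 ι ℂ}
    (hg : g ∈ shiftSpan f S) : T g ∈ K :=
  shiftSpan_le (K := K.comap (T : H2 ι ℂ →ₗ[ℂ] F)) (hK.preimage T.continuous) h hg

lemma map_eq_zero_of_mem_shiftSpan {F : Type*} [NormedAddCommGroup F] [NormedSpace ℂ F]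
    (T : H2 ι ℂ →L[ℂ] F) {f : H2 ι ℂ} {S : Set (List ι)}
    (h : ∀ β ∈ S, T (rightShift β f) = 0) {g : H2 ι ℂ} (hg : g ∈ shiftSpan f S) : T g = 0 := by
  simpa using map_mem_of_mem_shiftSpan T (K := ⊥) (by simp) (by simpa using h) hg

lemma rightShift_mem_of_mem_cyclic {f g : H2 ι ℂ} (hg : g ∈ cyclic f) (β : List ι) :
    rightShift β g ∈ cyclic f := by
  refine map_mem_of_mem_shiftSpan (rightShift β).toContinuousLinearMap
    (isClosed_shiftSpan f _) (fun α _ => ?_) hg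
  rw [LinearIsometry.coe_toContinuousLinearMap, rightShift_rightShift]
  exact rightShift_mem_shiftSpan f (Set.mem_univ _)

lemma rightShift_mem_of_ne_nil {f g : H2 ι ℂ} (hg : g ∈ cyclic f) {β : List ι} (hβ : β ≠ []) :
    rightShift β g ∈ shiftSpan f {[]}ᶜ := by
  refine map_mem_of_mem_shiftSpan (rightShift β).toContinuousLinearMap
    (isClosed_shiftSpan f _) (fun α _ => ?_) hg
  rw [LinearIsometry.coe_toContinuousLinearMap, rightShift_rightShift]
  exact rightShift_mem_shiftSpan f (by simp [hβ])

lemma adjoint_rightShift_apply (β : List ι) (h : H2 ι ℂ) (γ : List ι) :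
    adjoint (rightShift β).toContinuousLinearMap h γ = h (γ ++ β) := by
  classical
  have := ContinuousLinearMap.adjoint_inner_right (𝕜 := ℂ)
    (rightShift (E := ℂ) β).toContinuousLinearMap (lp.single 2 γ 1) h
  rw [LinearIsometry.coe_toContinuousLinearMap, rightShift_single, lp.inner_single_left,
    lp.inner_single_left] at this
  simpa using this

lemma inner_rightShift_of_last_ne {i j : ι} (hij : i ≠ j) (g h : H2 ι ℂ) :
    ⟪rightShift [i] g, rightShift [j] h⟫_ℂ = 0 := by
  refine (hasSum_inner_extendIsometry _ _ _ _).unique ?_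
  convert hasSum_zero with α
  rw [rightShift_of_not_suffix, inner_zero_left]
  rintro ⟨β, hβ⟩
  exact hij (by simpa using congrArg List.getLast? hβ)

/-- The right shifts of a wandering unit vector are orthonormal: cancel the common suffix of the
two words. -/
lemma orthonormal_rightShift {v : H2 ι ℂ} (hv : ‖v‖ = 1)
    (h : ∀ β, β ≠ [] → ⟪v, rightShift β v⟫_ℂ = 0) :
    Orthonormal ℂ fun β => rightShift β v := by
  refine ⟨fun β => by rw [LinearIsometry.norm_map, hv], fun α => ?_⟩
  induction α using List.reverseRecOn with
  | nil => intro β hβ; simpa using h β hβ.symm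
  | append_singleton α i ih =>
    intro β
    induction β using List.reverseRecOn with
    | nil =>
      intro hβ
      have := h _ hβ
      rw [← inner_conj_symm, map_eq_zero] at this
      simpa only [rightShift_nil] using this
    | append_singleton β j _ =>
      intro hαβ
      simp only
      rw [← rightShift_rightShift, ← rightShift_rightShift]
      by_cases hij : i = j
      · subst hij
        rw [LinearIsometry.inner_map_map]
        exact ih fun h => hαβ (by rw [h])
      · exact inner_rightShift_of_last_ne hij _ _

/-- At a word of minimal length in the support of `f`, all `f z^β` with `β` nonempty vanish. -/
lemma notMem_shiftSpan_compl_nil {f : H2 ι ℂ} (hf : f ≠ 0) : f ∉ shiftSpan f {[]}ᶜ := by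
  intro hmem
  obtain ⟨α, hfα, hmin⟩ := exists_forall_length_lt_not (P := fun α => f α ≠ 0) (by
    by_contra! H
    exact hf (by ext α; exact H α))
  refine hfα (map_eq_zero_of_mem_shiftSpan (lp.evalCLM ℂ (fun _ : List ι => ℂ) 2 α) ?_ hmem)
  intro β hβ
  change rightShift β f α = 0
  by_cases hs : β <:+ α
  · obtain ⟨δ, rfl⟩ := hs
    rw [rightShift_append]
    refine not_not.1 (hmin δ ?_)
    have := List.length_pos_iff.2 hβ
    rw [List.length_append]
    omega
  · exact rightShift_of_not_suffix _ hs

/-- A vector of the cyclic subspace of `f` orthogonal to the wandering vector `v` lies in the span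
of the proper shifts of `f`. -/
lemma mem_shiftSpan_of_inner_eq_zero {f g v : H2 ι ℂ} (hvf : ⟪v, f⟫_ℂ ≠ 0)
    (hv : v ∈ (shiftSpan f {[]}ᶜ)ᗮ) (hg : g ∈ cyclic f) (hgv : ⟪v, g⟫_ℂ = 0) :
    g ∈ shiftSpan f {[]}ᶜ := by
  -- The operator `g ↦ ⟪v, f⟫ g - ⟪v, g⟫ f` maps all shifts of `f` into the span of the proper ones.
  have key := map_mem_of_mem_shiftSpan
    (⟪v, f⟫_ℂ • ContinuousLinearMap.id ℂ (H2 ι ℂ) - (innerSL ℂ v).smulRight f)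
    (isClosed_shiftSpan f {[]}ᶜ) (fun β _ => ?_) hg
  · exact (Submodule.smul_mem_iff _ hvf).1 (by simpa [hgv] using key)
  · by_cases hβ : β = []
    · subst hβ; simp
    · have h1 := rightShift_mem_shiftSpan f (S := {[]}ᶜ) hβ
      have h2 := Submodule.inner_left_of_mem_orthogonal h1 hv
      simpa [h2] using Submodule.smul_mem _ _ h1

/-- A cyclic invariant subspace is the range of an isometric left multiplication. -/
theorem exists_inner_generator {f : H2 ι ℂ} (hf : f ≠ 0) :
    ∃ v ∈ cyclic f, Orthonormal ℂ (fun β => rightShift β v) ∧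
      ∀ g ∈ cyclic f, ∃ c : H2 ι ℂ, ‖c‖ = ‖g‖ ∧ ∀ γ,
        g γ = ∑ k ∈ Finset.range (γ.length + 1), c (γ.drop k) • v (γ.take k) := by
  set M₀ := shiftSpan f {[]}ᶜ with hM₀
  -- The generator is the normalized component of `f` orthogonal to its proper shifts.
  obtain ⟨p, hp, w, hw, hfpw⟩ := M₀.exists_add_mem_mem_orthogonal f
  have hw0 : w ≠ 0 := by
    intro h0
    rw [h0, add_zero] at hfpw
    have : f ∈ M₀ := by rw [hfpw]; exact hp
    exact notMem_shiftSpan_compl_nil hf this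
  have hle : M₀ ≤ cyclic f :=
    shiftSpan_le (isClosed_shiftSpan f _) fun β _ => rightShift_mem_shiftSpan f (Set.mem_univ β)
  have hwn : (‖w‖ : ℂ) ≠ 0 := by simpa using hw0
  set v : H2 ι ℂ := (‖w‖ : ℂ)⁻¹ • w with hv
  have hwv : w = (‖w‖ : ℂ) • v := by rw [hv, smul_inv_smul₀ hwn]
  have hvM : v ∈ cyclic f := by
    refine Submodule.smul_mem _ _ ?_
    rw [show w = f - p by rw [hfpw]; abel]
    exact Submodule.sub_mem _ (self_mem_cyclic f) (hle hp)
  have hvo : v ∈ M₀ᗮ := Submodule.smul_mem _ _ hw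
  have hv1 : ‖v‖ = 1 := by
    rw [hv, norm_smul, norm_inv]
    simp [hw0]
  have hvf : ⟪v, f⟫_ℂ ≠ 0 := by
    rw [hfpw, inner_add_right, Submodule.inner_left_of_mem_orthogonal hp hvo, zero_add, hwv,
      inner_smul_right, inner_self_eq_norm_sq_to_K, hv1]
    simpa using hw0
  have hon : Orthonormal ℂ (fun β => rightShift β v) :=
    orthonormal_rightShift hv1 fun β hβ =>
      Submodule.inner_left_of_mem_orthogonal (rightShift_mem_of_ne_nil hvM hβ) hvo
  -- A vector of the subspace orthogonal to all `v z^β` vanishes: strip the last letters one by one.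
  have hzero : ∀ γ : List ι, ∀ g ∈ cyclic f, (∀ β, ⟪rightShift β v, g⟫_ℂ = 0) → g γ = 0 := by
    intro γ
    induction γ using List.reverseRecOn with
    | nil =>
      intro g hg hgv
      have hg0 := mem_shiftSpan_of_inner_eq_zero hvf hvo hg (by simpa using hgv [])
      refine map_eq_zero_of_mem_shiftSpan (lp.evalCLM ℂ (fun _ : List ι => ℂ) 2 []) ?_ hg0
      intro β hβ
      exact rightShift_of_not_suffix _ (by simpa using hβ)
    | append_singleton γ i ih =>
      intro g hg hgv
      have hg0 := mem_shiftSpan_of_inner_eq_zero hvf hvo hg (by simpa using hgv [])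
      rw [← adjoint_rightShift_apply]
      refine ih _ ?_ fun β => ?_
      · refine map_mem_of_mem_shiftSpan _ (isClosed_shiftSpan f _) (fun β hβ => ?_) hg0
        obtain ⟨β', j, rfl⟩ := (List.eq_nil_or_concat' β).resolve_left hβ
        rw [← rightShift_rightShift]
        by_cases hij : i = j
        · subst hij
          have : adjoint (rightShift [i]).toContinuousLinearMap
              (rightShift [i] (rightShift β' f)) = rightShift β' f := by
            ext γ
            rw [adjoint_rightShift_apply, rightShift_append]
          rw [this]
          exact rightShift_mem_shiftSpan f (Set.mem_univ _)
        · have : adjoint (rightShift [i]).toContinuousLinearMap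
              (rightShift [j] (rightShift β' f)) = 0 := by
            ext γ
            rw [adjoint_rightShift_apply, rightShift_of_not_suffix]
            · rfl
            · rintro ⟨δ, hδ⟩
              exact hij (by simpa using (congrArg List.getLast? hδ).symm)
          rw [this]
          exact Submodule.zero_mem _
      · rw [ContinuousLinearMap.adjoint_inner_right, LinearIsometry.coe_toContinuousLinearMap,
          rightShift_rightShift]
        exact hgv _
  refine ⟨v, hvM, hon, fun g hg => ?_⟩
  set N := shiftSpan v Set.univ with hN
  have hNM : N ≤ cyclic f :=
    shiftSpan_le (isClosed_shiftSpan f _) fun β _ => rightShift_mem_of_mem_cyclic hvM β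
  obtain ⟨q, hq, u, hu, hgqu⟩ := N.exists_add_mem_mem_orthogonal g
  have hu0 : u = 0 := by
    ext γ
    refine hzero γ u ?_ fun β =>
      Submodule.inner_right_of_mem_orthogonal (rightShift_mem_shiftSpan v (Set.mem_univ β)) hu
    rw [show u = g - q by rw [hgqu]; abel]
    exact Submodule.sub_mem _ hg (hNM hq)
  have hgN : g ∈ N := by rw [hgqu, hu0, add_zero]; exact hq
  set T := hon.orthogonalFamily.linearIsometry with hT
  have hrange : N ≤ LinearMap.range T.toLinearMap := by
    refine shiftSpan_le T.isometry.isUniformInducing.isComplete_range.isClosed fun β _ => ?_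
    classical
    refine ⟨lp.single 2 β (1 : ℂ), ?_⟩
    refine (hon.orthogonalFamily.linearIsometry_apply_single (i := β) (1 : ℂ)).trans ?_
    simp
  obtain ⟨c, rfl⟩ := hrange hgN
  refine ⟨c, (T.norm_map c).symm, fun γ => ?_⟩
  have h1 := (lp.evalCLM ℂ (fun _ : List ι => ℂ) 2 γ).hasSum
    (hon.orthogonalFamily.hasSum_linearIsometry c)
  refine h1.unique ?_
  exact hasSum_smul_rightShift_apply v c γ

end Cyclic

/-! ### The singularity space and dilations -/

section Singularity

variable {ι : Type*}

open Filter Topology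
open scoped InnerProductSpace

lemma dilate_dilate (r s : unitInterval) (f : H2 ι ℂ) :
    dilate s (dilate r f) = dilate (s * r) f := by
  ext α
  simp [mul_pow, mul_assoc]

lemma dilate_rightShift (s : unitInterval) (β : List ι) (g : H2 ι ℂ) :
    dilate s (rightShift β g) = ((s : ℝ) : ℂ) ^ β.length • rightShift β (dilate s g) := by
  ext γ
  rw [lp.coeFn_smul, Pi.smul_apply, dilate_apply]
  by_cases hγ : β <:+ γ
  · obtain ⟨α, rfl⟩ := hγ
    rw [rightShift_append, rightShift_append, dilate_apply, List.length_append, pow_add,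
      smul_eq_mul]
    ring
  · rw [rightShift_of_not_suffix _ hγ, rightShift_of_not_suffix _ hγ, mul_zero, smul_zero]

lemma dilate_ne_zero {r : unitInterval} (hr : 0 < r) {f : H2 ι ℂ} (hf : f ≠ 0) :
    dilate r f ≠ 0 := by
  intro h
  refine hf ?_
  ext α
  have h1 : dilate r f α = 0 := by rw [h]; rfl
  rw [dilate_apply] at h1
  have hr' : ((r : ℝ) : ℂ) ≠ 0 := Complex.ofReal_ne_zero.2 (ne_of_gt hr)
  exact (mul_eq_zero.1 h1).resolve_left (pow_ne_zero _ hr')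

/-- Fock space over countably many letters is one of the levels `ℂ^n`, with `n = 1` if there are no
letters and `n = ∞` otherwise. -/
lemma exists_hilbertBasis_level (ι : Type*) [Countable ι] :
    ∃ n : ℕ∞, 1 ≤ n ∧ Nonempty (HilbertBasis (List ι) ℂ (Level n)) := by
  have key : ∀ n : ℕ∞, Nonempty (List ι ≃ {k : ℕ // (k : ℕ∞) < n}) →
      Nonempty (HilbertBasis (List ι) ℂ (Level n)) := by
    rintro n ⟨σ⟩
    refine ⟨HilbertBasis.ofRepr (LinearIsometryEquiv.ofSurjective
      (extendIsometry σ.symm σ.symm.injective) fun g =>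
        ⟨extendIsometry σ σ.injective g, ?_⟩)⟩
    ext α
    obtain ⟨k, rfl⟩ := σ.symm.surjective α
    rw [extendIsometry_apply]
    conv_lhs => rw [← σ.apply_symm_apply k]
    rw [extendIsometry_apply]
  rcases isEmpty_or_nonempty ι with hι | hι
  · refine ⟨1, le_rfl, key 1 ?_⟩
    have : Unique {k : ℕ // (k : ℕ∞) < 1} :=
      { default := ⟨0, by simp⟩
        uniq := fun k => Subtype.ext (by simpa using k.2) }
    exact ⟨Equiv.ofUnique _ _⟩
  · refine ⟨⊤, le_top, key ⊤ ?_⟩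
    obtain ⟨_⟩ := nonempty_denumerable (List ι)
    exact ⟨(Denumerable.eqv (List ι)).trans
      (Equiv.subtypeUnivEquiv fun k => ENat.natCast_lt_top k).symm⟩

/-- For `r < 1` the dilation of an element of the singularity space of `f` lies in the closure of
the range of `f(rL)`: a vector `y` orthogonal to that range gives the point `(rL, y)` of the left NC
variety of `f`. -/
lemma dilate_mem_cyclic [Countable ι] {f b : H2 ι ℂ} (hb : b ∈ singularitySpace f)
    {r : unitInterval} (hr : r < 1) : dilate r b ∈ cyclic (dilate r f) := by
  obtain ⟨n, hn, ⟨e⟩⟩ := exists_hilbertBasis_level ι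
  have hZ : ‖scaledLeftShift e r‖ < 1 := (norm_scaledLeftShift_le e r).trans_lt hr
  rw [← Submodule.orthogonal_orthogonal (cyclic (dilate r f)), Submodule.mem_orthogonal]
  intro y hy
  have key : ∀ (h : H2 ι ℂ) (β : List ι),
      ⟪e.repr.symm y, eval h (scaledLeftShift e r) (e β)⟫_ℂ = ⟪y, rightShift β (dilate r h)⟫_ℂ := by
    intro h β
    have h1 := (innerSL ℂ (e.repr.symm y)).hasSum (hasSum_eval_apply hZ h (e β))
    have h2 : HasSum (fun α => ⟪y (α ++ β), dilate r h α⟫_ℂ) ⟪y, rightShift β (dilate r h)⟫_ℂ :=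
      hasSum_inner_extendIsometry _ _ _ _
    refine h1.tsum_eq.symm.trans ((tsum_congr fun α => ?_).trans h2.tsum_eq)
    have h3 : ⟪e.repr.symm y, e (α ++ β)⟫_ℂ = (starRingEnd ℂ) (y (α ++ β)) := by
      rw [← inner_conj_symm, ← HilbertBasis.repr_apply_apply, LinearIsometryEquiv.apply_symm_apply]
    rw [wordPow_scaledLeftShift, innerSL_apply_apply, inner_smul_right, inner_smul_right, h3,
      dilate_apply, RCLike.inner_apply]
    ring
  have hzero : ∀ x, ⟪e.repr.symm y, eval f (scaledLeftShift e r) x⟫_ℂ = 0 := by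
    intro x
    have : (innerSL ℂ (e.repr.symm y)).comp (eval f (scaledLeftShift e r)) = 0 := by
      refine ContinuousLinearMap.ext_on (s := Set.range e)
        (Submodule.dense_iff_topologicalClosure_eq_top.2 e.dense_span) ?_
      rintro _ ⟨β, rfl⟩
      rw [ContinuousLinearMap.comp_apply, innerSL_apply_apply, key]
      exact Submodule.inner_left_of_mem_orthogonal
        (rightShift_mem_shiftSpan _ (Set.mem_univ β)) hy
    exact congrArg (fun T => T x) this
  have := hb n hn (scaledLeftShift e r, e.repr.symm y) ⟨hZ, hzero⟩ (e [])
  rwa [key, rightShift_nil] at this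

/-- If `y^* f(Z) = 0`, then `y^* g(Z / r) = 0` for all `g` in the closure of the range of `f(rL)`.
With `k` the kernel at `Z / t` and `t = s r`, the value `y^* g(Z / r) x` is `⟪k, g_s⟫`; in this form
the point `Z / t` need not depend on `r`. -/
lemma inner_kernel_dilate_eq_zero {E : Type*} [NormedAddCommGroup E] [InnerProductSpace ℂ E]
    [CompleteSpace E] {f : H2 ι ℂ} {Z : lp (fun _ : ι => E) 2 →L[ℂ] E} (hZ : ‖Z‖ < 1) {x y : E}
    (hy : ∀ x, ⟪y, eval f Z x⟫_ℂ = 0) {r s t : unitInterval} (ht : 0 < t) (hst : s * r = t)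
    {k : H2 ι ℂ} (hk : ∀ α, k α = ((t : ℝ) : ℂ)⁻¹ ^ α.length * ⟪wordPow Z α x, y⟫_ℂ)
    {g : H2 ι ℂ} (hg : g ∈ cyclic (dilate r f)) : ⟪k, dilate s g⟫_ℂ = 0 := by
  have ht' : ((t : ℝ) : ℂ) ≠ 0 := Complex.ofReal_ne_zero.2 (ne_of_gt ht)
  refine map_eq_zero_of_mem_shiftSpan ((innerSL ℂ k).comp (dilate s)) (fun β _ => ?_) hg
  rw [ContinuousLinearMap.comp_apply, innerSL_apply_apply, dilate_rightShift, inner_smul_right,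
    dilate_dilate, hst]
  refine mul_eq_zero_of_right _ ?_
  have h1 := ((innerSL ℂ y).hasSum (hasSum_eval_apply hZ f (wordPow Z β x))).mul_left
    (((t : ℝ) : ℂ)⁻¹ ^ β.length)
  rw [innerSL_apply_apply, hy, mul_zero] at h1
  have h2 : HasSum (fun α => ⟪k (α ++ β), dilate t f α⟫_ℂ) ⟪k, rightShift β (dilate t f)⟫_ℂ :=
    hasSum_inner_extendIsometry _ _ _ _
  refine h2.tsum_eq.symm.trans ((tsum_congr fun α => ?_).trans h1.tsum_eq)
  rw [hk, dilate_apply, RCLike.inner_apply, innerSL_apply_apply, inner_smul_right, map_mul,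
    inner_conj_symm, wordPow_append, List.length_append, pow_add, mul_apply_eq_comp]
  simp only [map_mul, map_pow, map_inv₀, Complex.conj_ofReal, inv_pow]
  field_simp

/-- A coefficientwise limit, for `r → 1`, of bounded elements of the closures of the ranges of
`f(rL)` lies in the singularity space of `f`. -/
lemma mem_singularitySpace_of_tendsto {X : Type*} {l : Filter X} [l.NeBot] {f V : H2 ι ℂ}
    {r : X → unitInterval} (hr : Tendsto (fun x => (r x : ℝ)) l (𝓝 1)) {v : X → H2 ι ℂ} {C : ℝ}
    (hv : ∀ x, ‖v x‖ ≤ C) (hmem : ∀ x, v x ∈ cyclic (dilate (r x) f))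
    (hV : ∀ α, Tendsto (fun x => v x α) l (𝓝 (V α))) : V ∈ singularitySpace f := by
  rintro n - ⟨Z, y⟩ ⟨hZ, hy⟩ x
  simp only at hZ hy ⊢
  obtain ⟨t₀, hZt, ht1⟩ := exists_between hZ
  have ht0 : 0 < t₀ := (norm_nonneg Z).trans_lt hZt
  set t : unitInterval := ⟨t₀, ht0.le, ht1.le⟩ with ht
  have htc : ((t : ℝ) : ℂ) ≠ 0 := by exact_mod_cast ht0.ne'
  have hZ' : ‖((t : ℝ) : ℂ)⁻¹ • Z‖ < 1 := by
    refine (ContinuousLinearMap.opNorm_smul_le _ _).trans_lt ?_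
    rw [norm_inv, Complex.norm_of_nonneg ht0.le, inv_mul_lt_iff₀ ht0, mul_one]
    exact hZt
  obtain ⟨k, hk, -⟩ := exists_kernel hZ' x y
  obtain ⟨k', hk', hk'e⟩ := exists_kernel hZ x y
  replace hk : ∀ α, k α = ((t : ℝ) : ℂ)⁻¹ ^ α.length * ⟪wordPow Z α x, y⟫_ℂ := by
    intro α
    rw [hk, wordPow_smul, smul_apply, inner_smul_left]
    simp
  -- Evaluate at the fixed point `Z / t`, with the elements dilated by `t / r x` in return.
  set s : X → unitInterval := fun x =>
    if h : t ≤ r x then ⟨t / r x, unitInterval.div_mem t.2.1 (r x).2.1 h⟩ else 0 with hs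
  have hev : ∀ᶠ x in l, t < r x := (hr.eventually_const_lt ht1).mono fun x hx => hx
  have hslim : Tendsto (fun x => (s x : ℝ)) l (𝓝 t) := by
    have h1 : Tendsto (fun x => (t : ℝ) / r x) l (𝓝 (t / 1)) :=
      tendsto_const_nhds.div hr one_ne_zero
    rw [div_one] at h1
    refine h1.congr' ?_
    filter_upwards [hev] with x hx
    simp [hs, hx.le]
  have hzero : ∀ᶠ x in l, ⟪k, dilate (s x) (v x)⟫_ℂ = 0 := by
    filter_upwards [hev] with x hx
    refine inner_kernel_dilate_eq_zero (t := t) hZ hy ht0 ?_ hk (hmem x)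
    have hrx : (r x : ℝ) ≠ 0 := (ht0.trans hx).ne'
    ext
    simp [hs, hx.le, hrx]
  have hlim := tendsto_inner_of_tendsto_apply (l := l) (W := fun x => dilate (s x) (v x))
    (w := dilate t V) (fun x => (norm_dilate_le _ _).trans (hv x)) (fun α => by
      simp only [dilate_apply]
      exact (((Complex.continuous_ofReal.tendsto _).comp hslim).pow _).mul (hV α)) k
  have h0 : ⟪k, dilate t V⟫_ℂ = 0 := tendsto_nhds_unique_of_eventuallyEq hlim tendsto_const_nhds hzero
  rw [← hk'e, ← h0, lp.inner_eq_tsum, lp.inner_eq_tsum]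
  refine tsum_congr fun α => ?_
  rw [hk, hk', dilate_apply, RCLike.inner_apply, RCLike.inner_apply]
  simp only [map_mul, map_pow, map_inv₀, Complex.conj_ofReal, inv_pow]
  field_simp

/-- Along an ultrafilter, a bounded family in `H²` has a coefficientwise limit. -/
lemma exists_tendsto_apply {X : Type*} (U : Ultrafilter X) {F : X → H2 ι ℂ} {C : ℝ}
    (hF : ∀ x, ‖F x‖ ≤ C) :
    ∃ w : H2 ι ℂ, ∀ α, Tendsto (fun x => F x α) U (𝓝 (w α)) := by
  have h : ∀ α, ∃ z : ℂ, Tendsto (fun x => F x α) U (𝓝 z) := by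
    intro α
    obtain ⟨z, -, hz⟩ := (isCompact_closedBall (0 : ℂ) C).ultrafilter_le_nhds
      (U.map fun x => F x α) (by
        rw [le_principal_iff, Ultrafilter.mem_coe, Ultrafilter.mem_map]
        refine Filter.Eventually.of_forall (fun x => ?_)
        exact mem_closedBall_zero_iff.2
          ((lp.norm_apply_le_norm (by simp) (F x) α).trans (hF x)))
    exact ⟨z, hz⟩
  choose w hw using h
  have hmem : Memℓp w 2 := lp.memℓp_of_tendsto (l := (U : Filter X)) (F := F)
    (isBounded_iff_forall_norm_le.2 ⟨C, by rintro _ ⟨x, rfl⟩; exact hF x⟩)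
    (by rw [tendsto_pi_nhds]; exact hw)
  exact ⟨⟨w, hmem⟩, hw⟩

end Singularity

/-! ### Left multipliers -/

section Multiplier

variable {ι κ : Type*}

open Filter Topology
open scoped InnerProductSpace

namespace LeftMultiplier

section General

variable {E J : Type*} [NormedAddCommGroup E] [NormedSpace ℂ E]
  [NormedAddCommGroup J] [NormedSpace ℂ J]

lemma op_rightShift (B : LeftMultiplier ι E J) (β : List ι) (h : H2 ι E) :
    B.op (rightShift β h) = rightShift β (B.op h) := by
  ext γ
  rw [B.op_apply]
  by_cases hγ : β <:+ γ
  · obtain ⟨δ, rfl⟩ := hγ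
    rw [rightShift_append, B.op_apply]
    symm
    refine (Finset.sum_congr rfl fun k hk => ?_).trans
      (Finset.sum_subset (Finset.range_mono (by simp)) fun k hk hk' => ?_)
    · have hk' : k ≤ δ.length := by simpa [Nat.lt_succ_iff] using hk
      rw [List.take_append_of_le_length hk', List.drop_append_of_le_length hk', rightShift_append]
    · rw [rightShift_of_not_suffix, map_zero]
      intro hs
      have := hs.length_le
      simp at this hk hk'
      omega
  · rw [rightShift_of_not_suffix _ hγ]
    refine Finset.sum_eq_zero fun k _ => ?_
    rw [rightShift_of_not_suffix _ fun hs => hγ (hs.trans (List.drop_suffix k γ)), map_zero]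

lemma op_single_nil_apply [DecidableEq (List ι)] (B : LeftMultiplier ι E J) (x : E)
    (γ : List ι) : B.op (lp.single 2 [] x) γ = B.coeff γ x := by
  rw [B.op_apply, Finset.sum_eq_single γ.length]
  · simp
  · intro k hk hne
    rw [lp.single_apply_ne, map_zero]
    simp at hk ⊢
    omega
  · simp

end General

lemma euc_eq_smul [Subsingleton κ] {v w : Euc κ} (hw : w ≠ 0) : ∃ c : ℂ, v = c • w := by
  obtain ⟨k, hk⟩ : ∃ k, w k ≠ 0 := by
    by_contra! H
    exact hw (by ext k; exact H k)
  refine ⟨v k / w k, ?_⟩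
  ext j
  rw [Subsingleton.elim j k, lp.coeFn_smul, Pi.smul_apply, smul_eq_mul, div_mul_cancel₀ _ hk]

/-- The free monoid ring has no zero divisors: the product of the coefficients at words of minimal
length in the supports of `F` and `h` is a coefficient of `F h`. -/
lemma injective_op [Subsingleton κ] (F : LeftMultiplier ι (Euc κ) ℂ)
    (hF : Nonempty κ → ∃ α, F.coeff α ≠ 0) : Function.Injective F.op := by
  rw [injective_iff_map_eq_zero]
  intro h hh
  by_contra hne
  obtain ⟨β, hβ, hβmin⟩ := exists_forall_length_lt_not (P := fun β => h β ≠ 0) (by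
    by_contra! H
    exact hne (by ext1; funext β; exact H β))
  have hκ : Nonempty κ := by
    by_contra hκ
    rw [not_nonempty_iff] at hκ
    exact hβ (by ext k; exact hκ.elim k)
  obtain ⟨α, hα, hαmin⟩ := exists_forall_length_lt_not (hF hκ)
  refine hα ?_
  have h0 : F.op h (α ++ β) = 0 := by rw [hh]; rfl
  rw [F.op_apply, Finset.sum_eq_single α.length] at h0
  · rw [List.take_left, List.drop_left] at h0
    ext v
    obtain ⟨c, rfl⟩ := euc_eq_smul (v := v) hβ
    rw [map_smul, h0, smul_zero]
    rfl
  · intro k hk hne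
    rcases lt_or_gt_of_ne hne with hlt | hgt
    · rw [not_not.1 (hαmin _ (by rw [List.length_take]; omega))]
      rfl
    · rw [not_not.1 (hβmin ((α ++ β).drop k) (by simp at hk ⊢; omega)), map_zero]
  · simp

end LeftMultiplier

lemma norm_sum_smul_rightShift_le {X : Type*} {l : Filter X} [l.NeBot] {v : X → H2 ι ℂ}
    {V : H2 ι ℂ} (hv : ∀ x, Orthonormal ℂ fun β => rightShift β (v x))
    (hV : ∀ α, Tendsto (fun x => v x α) l (𝓝 (V α))) (w : List ι → ℂ) (s : Finset (List ι)) :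
    ‖∑ β ∈ s, w β • rightShift β V‖ ^ 2 ≤ ∑ β ∈ s, ‖w β‖ ^ 2 := by
  have hR : ∀ β γ, Tendsto (fun x => rightShift β (v x) γ) l (𝓝 (rightShift β V γ)) := by
    intro β γ
    by_cases hγ : β <:+ γ
    · obtain ⟨α, rfl⟩ := hγ
      simpa only [rightShift_append] using hV α
    · simpa only [rightShift_of_not_suffix _ hγ] using tendsto_const_nhds
  refine (Real.le_sqrt (norm_nonneg _) (by positivity)).1 ?_
  refine lp.norm_le_of_tendsto (l := l) (F := fun x => ∑ β ∈ s, w β • rightShift β (v x))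
    (Eventually.of_forall fun x => (Real.le_sqrt (norm_nonneg _) (by positivity)).2 ?_) ?_
  · have := (hv x).orthogonalFamily.norm_sum w s
    simp only [LinearIsometry.toSpanSingleton_apply] at this
    exact this.le
  · rw [tendsto_pi_nhds]
    intro γ
    simp only [id, lp.coeFn_sum, Finset.sum_apply, lp.coeFn_smul, Pi.smul_apply]
    exact tendsto_finsetSum _ fun β _ => (hR β γ).const_smul _

/-- If the range of an inner row `B` is the singularity space of some `f ≠ 0`, then `B` has at most
one entry. -/
theorem subsingleton_of_range_eq_singularitySpace [Countable ι] {f : H2 ι ℂ} (hf : f ≠ 0)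
    {B : LeftMultiplier ι (Euc κ) ℂ} (hB : B.IsInner)
    (hrange : Set.range B.op = singularitySpace f) : Subsingleton κ := by
  classical
  have hnorm : ∀ h, ‖B.op h‖ = ‖h‖ :=
    (AddMonoidHomClass.isometry_iff_norm B.op).1 hB
  -- The inner generators `v r` of the closures of the ranges of `f(rL)`, for `0 < r < 1`.
  set r : Set.Ioo (0 : ℝ) 1 → unitInterval := fun x => ⟨x, x.2.1.le, x.2.2.le⟩ with hr
  choose v hvmem hvon hvgen using fun x : Set.Ioo (0 : ℝ) 1 =>
    exists_inner_generator (dilate_ne_zero (r := r x) x.2.1 hf)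
  have hv1 : ∀ x, ‖v x‖ ≤ 1 := fun x => by simpa using ((hvon x).1 []).le
  -- Their limit `V` along an ultrafilter of radii tending to `1` lies in the range of `B`.
  have hne : (comap ((↑) : Set.Ioo (0 : ℝ) 1 → ℝ) (𝓝 1)).NeBot := by
    rw [← mem_closure_iff_comap_neBot, closure_Ioo (by norm_num)]
    simp
  set U := Ultrafilter.of (comap ((↑) : Set.Ioo (0 : ℝ) 1 → ℝ) (𝓝 1))
  have hrlim : Tendsto (fun x => (r x : ℝ)) U (𝓝 1) :=
    tendsto_comap.mono_left (Ultrafilter.of_le _)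
  obtain ⟨V, hV⟩ := exists_tendsto_apply U hv1
  have hVmem : V ∈ singularitySpace f := mem_singularitySpace_of_tendsto hrlim hv1 hvmem hV
  rw [← hrange] at hVmem
  obtain ⟨G, hG⟩ := hVmem
  -- From `B e = V w` and `V = B G` it follows that `e = G w`, hence `e = w_∅ G_∅`.
  have key : ∀ e : Euc κ, ∃ c : ℂ, e = c • G [] := by
    intro e
    set b := B.op (lp.single 2 [] e) with hbdef
    have hb : b ∈ singularitySpace f := hrange ▸ Set.mem_range_self _
    choose c hcn hc using fun x : Set.Ioo (0 : ℝ) 1 =>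
      hvgen x _ (dilate_mem_cyclic hb (r := r x) x.2.2)
    obtain ⟨w, hw⟩ := exists_tendsto_apply U (F := c) fun x => (hcn x).trans_le (norm_dilate_le _ _)
    have hbw : ∀ γ, b γ =
        ∑ k ∈ Finset.range (γ.length + 1), w (γ.drop k) • V (γ.take k) := by
      intro γ
      have h1 : Tendsto (fun x => dilate (r x) b γ) U (𝓝 (b γ)) := by
        simp only [dilate_apply]
        simpa using (((Complex.continuous_ofReal.tendsto _).comp hrlim).pow γ.length).mul_const (b γ)
      refine tendsto_nhds_unique h1 ?_
      simp only [hc]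
      exact tendsto_finsetSum _ fun k _ => (hw _).smul (hV _)
    have hBG : ∀ β, B.op (w β • rightShift β G) = w β • rightShift β V := fun β => by
      rw [map_smul, LeftMultiplier.op_rightShift, hG]
    have hsum : Summable fun β => w β • rightShift β G := by
      refine summable_of_norm_sum_sq_le (summable_norm_sq w) (K := 1) fun s => ?_
      rw [one_mul, ← hnorm, map_sum]
      simp only [hBG]
      exact norm_sum_smul_rightShift_le hvon hV w s
    have hg : ∑' β, w β • rightShift β G = lp.single 2 [] e := by
      refine hB.injective ?_
      ext γ
      rw [← hbdef, hbw]
      have h1 := (lp.evalCLM ℂ (fun _ : List ι => ℂ) 2 γ).hasSum (B.op.hasSum hsum.hasSum)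
      simp only [hBG] at h1
      exact h1.unique (hasSum_smul_rightShift_apply V w γ)
    have h2 := (lp.evalCLM ℂ (fun _ : List ι => Euc κ) 2 []).hasSum hsum.hasSum
    have h3 := h2.unique (hasSum_smul_rightShift_apply G w [])
    refine ⟨w [], ?_⟩
    rw [hg] at h3
    have h4 : lp.single (E := fun _ : List ι => Euc κ) 2 [] e [] = e := lp.single_apply_self _ _ _
    rw [← h4]
    refine h3.trans ?_
    simp
  refine ⟨fun j k => ?_⟩
  by_contra hjk
  obtain ⟨c, hc⟩ := key (lp.single 2 j 1)
  obtain ⟨d, hd⟩ := key (lp.single 2 k 1)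
  have hc' : ∀ i, (lp.single 2 j 1 : Euc κ) i = c * G [] i := fun i => by rw [hc]; rfl
  have hd' : ∀ i, (lp.single 2 k 1 : Euc κ) i = d * G [] i := fun i => by rw [hd]; rfl
  have h1 := hc' j
  have h2 := hc' k
  have h3 := hd' k
  rw [lp.single_apply_self] at h1 h3
  rw [lp.single_apply_ne _ _ _ (Ne.symm hjk)] at h2
  rcases mul_eq_zero.1 h2.symm with h | h
  · simp [h] at h1
  · simp [h] at h3

/-! ### The dilated multiplier -/

/-- The `k`-th coordinate of a power series with coefficients in `ℂ^N`. -/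
def coordinate (k : κ) : H2 ι (Euc κ) →L[ℂ] H2 ι ℂ :=
  LinearMap.mkContinuous
    { toFun := fun h => ⟨fun α => h α k, memℓp_two_iff.2 <|
        Summable.of_nonneg_of_le (fun _ => by positivity) (fun α => by
          gcongr
          exact lp.norm_apply_le_norm (by simp) (h α) k) (summable_norm_sq h)⟩
      map_add' := fun g h => rfl
      map_smul' := fun c h => rfl } 1 fun h => by
    rw [one_mul, ← sq_le_sq₀ (norm_nonneg _) (norm_nonneg _), norm_sq_eq_tsum, norm_sq_eq_tsum]
    refine Summable.tsum_le_tsum (fun α => ?_) (summable_norm_sq _) (summable_norm_sq _)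
    gcongr
    exact lp.norm_apply_le_norm (by simp) (h α) k

@[simp]
lemma coordinate_apply (k : κ) (h : H2 ι (Euc κ)) (α : List ι) :
    coordinate k h α = h α k := rfl

lemma wordPow_scaledLeftShift_apply (r : unitInterval) (α : List ι) (g : H2 ι ℂ) :
    wordPow (scaledLeftShift (HilbertBasis.ofRepr (LinearIsometryEquiv.refl ℂ (H2 ι ℂ))) r) α g =
      ((r : ℝ) : ℂ) ^ α.length •
        extendIsometry (fun β => α ++ β) (List.append_right_injective α) g := by
  classical
  set e : HilbertBasis (List ι) ℂ (H2 ι ℂ) :=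
    HilbertBasis.ofRepr (LinearIsometryEquiv.refl ℂ (H2 ι ℂ)) with he
  have hsingle : ∀ β, e β = lp.single 2 β (1 : ℂ) := fun β => (e.repr_self β)
  have : wordPow (scaledLeftShift e r) α = ((r : ℝ) : ℂ) ^ α.length •
      (extendIsometry (E := ℂ) (fun β => α ++ β)
        (List.append_right_injective α)).toContinuousLinearMap := by
    refine ContinuousLinearMap.ext_on (s := Set.range e)
      (Submodule.dense_iff_topologicalClosure_eq_top.2 e.dense_span) ?_
    rintro _ ⟨β, rfl⟩
    rw [wordPow_scaledLeftShift, smul_apply, LinearIsometry.coe_toContinuousLinearMap, hsingle,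
      hsingle, extendIsometry_single]
  rw [this]
  rfl

/-- The value of a scalar power series `b` at the row `rL` is the left multiplication by `b_r`. -/
lemma eval_scaledLeftShift_apply {r : unitInterval} (hr : r < 1) (b g : H2 ι ℂ) (γ : List ι) :
    eval b (scaledLeftShift (HilbertBasis.ofRepr (LinearIsometryEquiv.refl ℂ (H2 ι ℂ))) r) g γ =
      ∑ k ∈ Finset.range (γ.length + 1),
        ((r : ℝ) : ℂ) ^ (γ.take k).length * b (γ.take k) * g (γ.drop k) := by
  classical
  have hZ := (norm_scaledLeftShift_le (HilbertBasis.ofRepr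
    (LinearIsometryEquiv.refl ℂ (H2 ι ℂ))) r).trans_lt hr
  have h1 := (lp.evalCLM ℂ (fun _ : List ι => ℂ) 2 γ).hasSum (hasSum_eval_apply hZ b g)
  refine h1.unique ?_
  have hinj : Set.InjOn (fun k => γ.take k) (Finset.range (γ.length + 1)) := by
    intro j hj k hk hjk
    have := congrArg List.length hjk
    simp only [List.length_take, Finset.coe_range, Set.mem_Iio] at this hj hk
    omega
  have hterm : ∀ α, lp.evalCLM ℂ (fun _ : List ι => ℂ) 2 γ (b α • wordPow (scaledLeftShift
      (HilbertBasis.ofRepr (LinearIsometryEquiv.refl ℂ (H2 ι ℂ))) r) α g) =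
      ((r : ℝ) : ℂ) ^ α.length * b α *
        extendIsometry (fun β => α ++ β) (List.append_right_injective α) g γ := by
    intro α
    rw [wordPow_scaledLeftShift_apply, smul_smul, mul_comm]
    rfl
  simp only [hterm]
  have h2 := hasSum_sum_of_ne_finset_zero (α := ℂ) (L := SummationFilter.unconditional _)
    (f := fun α => ((r : ℝ) : ℂ) ^ α.length * b α *
      extendIsometry (fun β => α ++ β) (List.append_right_injective α) g γ)
    (s := (Finset.range (γ.length + 1)).image fun k => γ.take k) (fun α hα => by
      rw [extendIsometry_apply_of_notMem, mul_zero]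
      rintro β rfl
      exact hα (Finset.mem_image.2 ⟨α.length, by simp, by simp⟩))
  rw [Finset.sum_image hinj] at h2
  have h3 : ∀ k, extendIsometry (fun β => γ.take k ++ β) (List.append_right_injective _) g γ =
      g (γ.drop k) := by
    intro k
    have := extendIsometry_apply (fun β => γ.take k ++ β) (List.append_right_injective _) g
      (γ.drop k)
    rwa [List.take_append_drop] at this
  simp only [h3] at h2
  exact h2

/-- A row with at most one entry has bounded dilations. -/
lemma exists_isDilation [Subsingleton κ] (B : LeftMultiplier ι (Euc κ) ℂ) {r : unitInterval}
    (hr : r < 1) : ∃ Br, LeftMultiplier.IsDilation r B Br := by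
  classical
  rcases isEmpty_or_nonempty κ with hκ | ⟨⟨k⟩⟩
  · have hzero : ∀ v : Euc κ, v = 0 := fun v => by ext k; exact hκ.elim k
    exact ⟨⟨fun α => ((r : ℝ) : ℂ) ^ α.length • B.coeff α, 0, fun h γ =>
      (Finset.sum_eq_zero fun j _ => by rw [hzero (h _), map_zero]).symm⟩, fun α => rfl⟩
  · set u : Euc κ := lp.single 2 k 1 with hu
    have hv : ∀ v : Euc κ, v = v k • u := by
      intro v
      ext j
      rw [Subsingleton.elim j k, lp.coeFn_smul, Pi.smul_apply, hu, lp.single_apply_self]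
      simp
    refine ⟨⟨fun α => ((r : ℝ) : ℂ) ^ α.length • B.coeff α,
      (eval (B.op (lp.single 2 [] u)) (scaledLeftShift (HilbertBasis.ofRepr
        (LinearIsometryEquiv.refl ℂ (H2 ι ℂ))) r)).comp (coordinate k), fun h γ => ?_⟩,
      fun α => rfl⟩
    rw [ContinuousLinearMap.comp_apply, eval_scaledLeftShift_apply hr]
    refine Finset.sum_congr rfl fun j _ => ?_
    rw [LeftMultiplier.op_single_nil_apply, coordinate_apply, smul_apply]
    conv_rhs => rw [hv (h (γ.drop j)), map_smul]
    simp only [smul_eq_mul]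
    ring

end Multiplier

end NCHardy

end

theorem mainTheorem4 {ι κ : Type*} [Countable ι] [Countable κ]
    (Θ : NCHardy.LeftMultiplier ι ℂ ℂ) (hΘ : Θ.IsInner)
    (B : NCHardy.LeftMultiplier ι (NCHardy.Euc κ) ℂ) (hB : NCHardy.IsBlaschkeRowFactor Θ B)
    (r : ℝ) (hr : r ∈ Set.Ioc (0 : ℝ) 1) :
    ∃ Br : NCHardy.LeftMultiplier ι (NCHardy.Euc κ) ℂ,
      NCHardy.LeftMultiplier.IsDilation r B Br ∧ Function.Injective Br.op := by
  classical
  rcases hr.2.eq_or_lt with rfl | hr1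
  · exact ⟨B, fun α => by simp, hB.inner.injective⟩
  have hf : Θ.toH2 ≠ 0 := by
    intro h
    have h1 := (AddMonoidHomClass.isometry_iff_norm Θ.op).1 hΘ (lp.single 2 [] 1)
    rw [show Θ.op (lp.single 2 [] 1) = 0 from h, norm_zero, lp.norm_single (by norm_num)] at h1
    simp at h1
  have hκ : Subsingleton κ :=
    NCHardy.subsingleton_of_range_eq_singularitySpace hf hB.inner hB.range_eq
  obtain ⟨Br, hBr⟩ := NCHardy.exists_isDilation B (r := ⟨r, hr.1.le, hr.2⟩) hr1
  refine ⟨Br, hBr, NCHardy.LeftMultiplier.injective_op Br ?_⟩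
  rintro ⟨k⟩
  by_contra! H
  have hB0 : ∀ α, B.coeff α = 0 := fun α =>
    (smul_eq_zero.1 ((hBr α).symm.trans (H α))).resolve_left
      (pow_ne_zero _ (Complex.ofReal_ne_zero.2 hr.1.ne'))
  have h1 : B.op (lp.single 2 [] (lp.single 2 k 1)) = 0 := by
    ext γ
    rw [NCHardy.LeftMultiplier.op_single_nil_apply, hB0]
    rfl
  have h2 := (AddMonoidHomClass.isometry_iff_norm B.op).1 hB.inner
    (lp.single 2 [] (lp.single 2 k 1))
  rw [h1, norm_zero, lp.norm_single (by norm_num), lp.norm_single (by norm_num)] at h2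
  simp at h2
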